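/- For a finite connected graph $G$, let $\ell(G)$ be its max leaf number, i.e. the maximum number of leaves (degree-one vertices) of a spanning tree of $G$. A branch of $G$ is a maximal (with respect to inclusion of subgraphs) path with at least one edge, or cycle, in which every internal vertex has degree two in $G$; here a cycle is regarded as a closed path starting and ending at one of its vertices, and its other vertices are its internal vertices. Let $b(G)$ be the number of branches of $G$. An instance of a graph problem consists of a finite connected graph $G$ and possibly further input (a bit string), encoded as a string of length $|I|$ (the adjacency matrix followed by the further input). A graph problem prescribes a set of admissible instances and the correct answers (bit strings) for each of them. A graph algorithm (a multi-stack Turing machine) is fixed-parameter tractable for a parameter $\kappa\in\{\ell,b\}$ on a set $S$ of instances if there are a computable function $f:\mathbb{N}\to\mathbb{N}$ and a polynomial $p$ such that it halts on each instance $I\in S$, with graph $G$, within $f(\kappa(G))\cdot p(|I|)$ steps. Then: 1. for every graph algorithm $A$ and every set $S$ of instances, $A$ is fixed-parameter tractable on $S$ for the max leaf number if and only if it is fixed-parameter tractable on $S$ for the number of branches; 2. consequently, every graph problem is solved by an algorithm that is fixed-parameter tractable (on the admissible instances) for the max leaf number if and only if it is solved by an algorithm that is fixed-parameter tractable for the number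 of branches. -/

import Mathlib

namespace ParamGraph

section Parameters

variable {V : Type*}

/-- The number of leaves (vertices of degree one) of a graph. -/
noncomputable def leafCount (T : SimpleGraph V) : ℕ :=
  {v : V | (T.neighborSet v).ncard = 1}.ncard

/-- The max leaf number of a (finite, connected) graph: the maximum number of leaves of a spanning
tree. A spanning tree of `G` is a tree on the vertex set of `G` all of whose edges are edges
of `G`. -/
noncomputable def maxLeafNumber (G : SimpleGraph V) : ℕ :=
  sSup {l : ℕ | ∃ T : SimpleGraph V, T ≤ G ∧ T.IsTree ∧ leafCount T = l}

/-- The subgraph `H` of `G` is a path with at least one edge in which every internal vertex has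
degree two in `G`. -/
def IsDegreeTwoPath (G : SimpleGraph V) (H : G.Subgraph) : Prop :=
  ∃ (u v : V) (p : G.Walk u v), p.IsPath ∧ 0 < p.length ∧
    (∀ x ∈ p.support, x ≠ u → x ≠ v → (G.neighborSet x).ncard = 2) ∧ p.toSubgraph = H

/-- The subgraph `H` of `G` is a cycle in which every internal vertex has degree two in `G`:
a cycle is a closed path from a vertex `u` back to `u`, and its internal vertices are those
other than `u`. So all vertices of the cycle, with at most one exception, have degree two. -/
def IsDegreeTwoCycle (G : SimpleGraph V) (H : G.Subgraph) : Prop :=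
  ∃ (u : V) (c : G.Walk u u), c.IsCycle ∧
    (∀ x ∈ c.support, x ≠ u → (G.neighborSet x).ncard = 2) ∧ c.toSubgraph = H

/-- A branch of `G` is a maximal path or cycle in which every internal vertex has degree two
in `G`. -/
def IsBranch (G : SimpleGraph V) (H : G.Subgraph) : Prop :=
  Maximal (fun H' : G.Subgraph => IsDegreeTwoPath G H' ∨ IsDegreeTwoCycle G H') H

/-- The number of branches of a (finite) graph. -/
noncomputable def branchNumber (G : SimpleGraph V) : ℕ :=
  {H : G.Subgraph | IsBranch G H}.ncard

end Parameters

section Problems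

/-- An instance of a graph problem: a finite connected graph, together with a bit string that holds
any further input (a target value, say; it is empty when the graph is the whole input). -/
structure GraphInstance where
  /-- the number of vertices -/
  n : ℕ
  /-- the input graph -/
  graph : SimpleGraph (Fin n)
  connected : graph.Connected
  /-- the further input -/
  extra : List Bool

open Classical in
/-- The string that represents an instance: the `n * n` bits of the adjacency matrix, row by row,
then a separator, then the further input. -/
noncomputable def GraphInstance.encode (I : GraphInstance) : List (Option Bool) :=
  ((List.finRange I.n).flatMap fun i =>
      (List.finRange I.n).map fun j => some (decide (I.graph.Adj i j))) ++
    none :: I.extra.map some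

/-- The size of an instance: the length of its encoding. -/
noncomputable def GraphInstance.size (I : GraphInstance) : ℕ := I.encode.length

/-- A graph problem: a set of admissible instances and, for each instance, the set of its correct
answers, written as bit strings. Decision problems, function problems and search
problems are special cases. -/
structure GraphProblem where
  instances : Set GraphInstance
  answers : GraphInstance → Set (List Bool)

/-- A graph algorithm: a multi-stack Turing machine (Mathlib's `FinTM2`) that reads the encodings of
instances and writes bit strings. -/
abbrev GraphAlgorithm : Type 1 := Turing.TM2ComputableAux (Option Bool) Bool

/-- On the instance `I` the algorithm halts with output `out` after at most `t` steps. -/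
def GraphAlgorithm.OutputsWithin (A : GraphAlgorithm) (I : GraphInstance) (out : List Bool)
    (t : ℕ) : Prop :=
  Nonempty (Turing.TM2OutputsInTime A.tm (I.encode.map A.inputAlphabet.symm)
    (some (out.map A.outputAlphabet.symm)) t)

/-- The algorithm solves the problem: on every admissible instance it halts with a correct
answer. -/
def GraphAlgorithm.Solves (A : GraphAlgorithm) (P : GraphProblem) : Prop :=
  ∀ I ∈ P.instances, ∃ out ∈ P.answers I, ∃ t : ℕ, A.OutputsWithin I out t

/-- The algorithm is fixed-parameter tractable on the instances in `S` for the parameter `κ`: it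
halts within `f (κ I) * p (size of I)` steps on each of them, where `f` is a computable function
and `p` is a polynomial. -/
def GraphAlgorithm.IsFPT (A : GraphAlgorithm) (S : Set GraphInstance) (κ : GraphInstance → ℕ) :
    Prop :=
  ∃ (f : ℕ → ℕ) (p : Polynomial ℕ), Computable f ∧
    ∀ I ∈ S, ∃ out : List Bool, A.OutputsWithin I out (f (κ I) * p.eval I.size)

/-- The problem is fixed-parameter tractable for the parameter `κ`: some algorithm that solves it
is. -/
def GraphProblem.IsFPT (P : GraphProblem) (κ : GraphInstance → ℕ) : Prop :=
  ∃ A : GraphAlgorithm, A.Solves P ∧ A.IsFPT P.instances κ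

end Problems

end ParamGraph

/-!
The max leaf number `ℓ` and the number of branches `b` of a finite connected graph `G` bound each
other by fixed polynomials, so a running time that is bounded in terms of one parameter is bounded
in terms of the other (`GraphAlgorithm.IsFPT.of_le`).

*Bounding `ℓ`* (`maxLeafNumber_le`). Every edge lies in a branch, a branch has at most two vertices
of degree different from two, and each vertex has at most two neighbors in it. So there are at most
`2 b` vertices of positive degree different from two, and all degrees are at most `2 b`. For a
spanning tree, the numbers `2 - deg_T v` add up to two; the leaves that have degree two in `G`
contribute one each, and only the vertices of degree different from two contribute negatively.

*Bounding `b`* (`branchNumber_le`). A branch, unless it is a cycle that makes up the whole graph,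
runs between vertices of degree different from two, by maximality, and it is determined by its
first edge, since a vertex of degree two leaves only one way onwards (`IsThread.toSubgraph_eq`). So
it suffices to bound the degrees and the number of vertices of degree different from two. Vertices
of degree one are leaves of every spanning tree. The stars at vertices with pairwise disjoint closed
neighborhoods extend to a spanning tree, which has many leaves (`IsSeparated.two_add_sum_le`). For a
single star this bounds the degrees by `ℓ`. For several stars at vertices of degree at least three
it shows that there are at most `ℓ` of them; if there are as many as possible, then every vertex of
degree at least three is within distance two of one of their centers.
-/

namespace ParamGraph

open SimpleGraph Finset

variable {V : Type*}

/-! ### Degrees and leaves of spanning trees -/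

section Trees

variable [Fintype V]

open Classical in
lemma ncard_neighborSet_eq_degree (G : SimpleGraph V) (v : V) :
    (G.neighborSet v).ncard = G.degree v := by
  rw [Set.ncard_eq_toFinset_card', ← G.card_neighborSet_eq_degree, Set.toFinset_card]

lemma ncard_neighborSet_mono {T G : SimpleGraph V} (h : T ≤ G) (v : V) :
    (T.neighborSet v).ncard ≤ (G.neighborSet v).ncard :=
  Set.ncard_le_ncard (fun _ hw => h hw) (Set.toFinite _)

lemma _root_.SimpleGraph.Adj.ncard_neighborSet_pos {G : SimpleGraph V} {v w : V} (h : G.Adj v w) :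
    0 < (G.neighborSet v).ncard :=
  (Set.ncard_pos (Set.toFinite _)).2 ⟨w, h⟩

open Classical in
lemma leafCount_eq_card (T : SimpleGraph V) :
    leafCount T = #{v | (T.neighborSet v).ncard = 1} := by
  rw [leafCount, Set.ncard_eq_toFinset_card']
  congr 1
  ext
  simp

lemma leafCount_le_card (T : SimpleGraph V) : leafCount T ≤ Fintype.card V := by
  classical
  rw [leafCount_eq_card]
  exact card_le_univ _

lemma leafCount_le_maxLeafNumber {G T : SimpleGraph V} (h : T ≤ G) (hT : T.IsTree) :
    leafCount T ≤ maxLeafNumber G := by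
  refine le_csSup ⟨Fintype.card V, ?_⟩ ⟨T, h, hT, rfl⟩
  rintro _ ⟨T', -, -, rfl⟩
  exact leafCount_le_card T'

lemma exists_isTree_leafCount_eq_maxLeafNumber {G : SimpleGraph V} (hG : G.Connected) :
    ∃ T ≤ G, T.IsTree ∧ leafCount T = maxLeafNumber G := by
  obtain ⟨T₀, h₀, hT₀⟩ := hG.exists_isTree_le
  refine Nat.sSup_mem (s := {l | ∃ T ≤ G, T.IsTree ∧ leafCount T = l}) ⟨_, T₀, h₀, hT₀, rfl⟩
    ⟨Fintype.card V, ?_⟩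
  rintro _ ⟨T', -, -, rfl⟩
  exact leafCount_le_card T'

/-- The handshaking lemma for a tree with `n` vertices, with the equation `2 (n - 1) = 2 n - 2`
rearranged so that every vertex contributes `2` minus its degree. -/
lemma sum_two_sub_ncard_neighborSet_of_isTree {T : SimpleGraph V} (hT : T.IsTree) :
    ∑ v, (2 - ((T.neighborSet v).ncard : ℤ)) = 2 := by
  classical
  have h1 := T.sum_degrees_eq_twice_card_edges
  have h2 := hT.card_edgeFinset
  simp_rw [ncard_neighborSet_eq_degree, Finset.sum_sub_distrib, ← Nat.cast_sum, h1]
  simp only [sum_const, card_univ, ← h2]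
  push_cast
  ring

/-- A tree has many leaves as soon as some of its vertices have large degree: leaves are the only
vertices that contribute positively to the sum of `2 - deg v`, which is `2`. -/
lemma two_add_sum_ncard_neighborSet_le {T : SimpleGraph V} (hT : T.IsTree) {C : Finset V}
    (hC : C.Nonempty) :
    2 + ∑ v ∈ C, (T.neighborSet v).ncard ≤ leafCount T + 2 * #C := by
  classical
  have h := sum_two_sub_ncard_neighborSet_of_isTree hT
  rw [← sum_add_sum_compl C, sum_sub_distrib, sum_const] at h
  have h' : ∑ v ∈ Cᶜ, (2 - ((T.neighborSet v).ncard : ℤ)) ≤ leafCount T := by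
    rw [leafCount_eq_card, card_filter, Nat.cast_sum]
    refine (sum_le_sum fun v hv => ?_).trans
      (sum_le_sum_of_subset_of_nonneg (subset_univ Cᶜ) fun _ _ _ => by positivity)
    -- The vertices `v ∉ C` and `c ∈ C` differ, so the tree has an edge at `v`.
    obtain ⟨c, hc⟩ := hC
    have : Nontrivial V := ⟨v, c, fun h => by simp_all⟩
    obtain ⟨w, hw⟩ := hT.connected.preconnected.exists_adj_of_nontrivial v
    have := hw.ncard_neighborSet_pos
    split_ifs <;> push_cast <;> lia
  zify
  simp only [nsmul_eq_mul] at h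
  linarith

end Trees

/-! ### Star forests in spanning trees -/

section Stars

/-- The vertices in `C` have pairwise disjoint closed neighborhoods in `G`. -/
def IsSeparated (G : SimpleGraph V) (C : Finset V) : Prop :=
  ∀ ⦃a⦄, a ∈ C → ∀ ⦃b⦄, b ∈ C → a ≠ b → ¬ G.Adj a b ∧ ∀ x, G.Adj a x → ¬ G.Adj x b

/-- The subgraph formed by the edges of `G` that have an end in `C`. -/
def starGraph (G : SimpleGraph V) (C : Finset V) : SimpleGraph V where
  Adj a b := G.Adj a b ∧ (a ∈ C ∨ b ∈ C)
  symm := ⟨fun _ _ h => ⟨h.1.symm, h.2.symm⟩⟩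
  loopless := ⟨fun _ h => h.1.ne rfl⟩

/-- If `C` is separated, the edges at `C` form disjoint stars: every edge has an end outside `C`,
and that end has only one neighbor, so it does not lie on a cycle. -/
lemma IsSeparated.isAcyclic_starGraph {G : SimpleGraph V} {C : Finset V} (hC : IsSeparated G C) :
    (starGraph G C).IsAcyclic := by
  intro u c hc
  have key : ∀ x ∈ c.support, x ∈ C := by
    intro x hx
    by_contra hxC
    have h2 := hc.ncard_neighborSet_toSubgraph_eq_two hx
    obtain ⟨a, b, hab, h⟩ := Set.ncard_eq_two.1 h2
    have ha : (starGraph G C).Adj x a := c.toSubgraph.adj_sub (by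
      change a ∈ c.toSubgraph.neighborSet x; simp [h])
    have hb : (starGraph G C).Adj x b := c.toSubgraph.adj_sub (by
      change b ∈ c.toSubgraph.neighborSet x; simp [h])
    exact (hC (ha.2.resolve_left hxC) (hb.2.resolve_left hxC) hab).2 x ha.1.symm hb.1
  have h := c.adj_snd hc.not_nil
  exact (hC (key _ c.start_mem_support) (key _ (c.getVert_mem_support 1)) h.ne).1 h.1

variable [Fintype V]

/-- The maximum leaf number is large if `G` has a separated set of vertices of large degree: the
stars at these vertices extend to a spanning tree. -/
lemma IsSeparated.two_add_sum_le {G : SimpleGraph V} (hG : G.Connected) {C : Finset V}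
    (hC : IsSeparated G C) (hne : C.Nonempty) :
    2 + ∑ v ∈ C, (G.neighborSet v).ncard ≤ maxLeafNumber G + 2 * #C := by
  obtain ⟨T, hFT, hTG, hT⟩ := hG.exists_isTree_le_of_le_of_isAcyclic
    (show starGraph G C ≤ G from fun _ _ h => h.1) hC.isAcyclic_starGraph
  have h := two_add_sum_ncard_neighborSet_le hT hne
  have h' := leafCount_le_maxLeafNumber hTG hT
  have h'' : ∑ v ∈ C, (G.neighborSet v).ncard ≤ ∑ v ∈ C, (T.neighborSet v).ncard :=
    sum_le_sum fun v hv =>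
      Set.ncard_le_ncard (fun w hw => hFT ⟨hw, Or.inl hv⟩) (Set.toFinite _)
  lia

lemma ncard_neighborSet_le_maxLeafNumber {G : SimpleGraph V} (hG : G.Connected) (v : V) :
    (G.neighborSet v).ncard ≤ maxLeafNumber G := by
  have h := IsSeparated.two_add_sum_le hG (C := {v}) (by
    intro a ha b hb hab
    simp only [mem_singleton] at ha hb
    exact absurd (ha.trans hb.symm) hab) (singleton_nonempty v)
  simp only [sum_singleton, card_singleton] at h
  lia

lemma IsSeparated.card_le_maxLeafNumber {G : SimpleGraph V} (hG : G.Connected) {C : Finset V}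
    (hC : IsSeparated G C) (h3 : ∀ v ∈ C, 3 ≤ (G.neighborSet v).ncard) :
    #C ≤ maxLeafNumber G := by
  rcases C.eq_empty_or_nonempty with rfl | hne
  · simp
  have h := hC.two_add_sum_le hG hne
  have h' := card_nsmul_le_sum C _ 3 h3
  simp only [smul_eq_mul] at h'
  lia

open Classical in
/-- A maximal separated set of vertices of degree at least three has at most `ℓ` elements, and all
vertices of degree at least three are within distance two of it. Degrees are at most `ℓ`, too. -/
lemma card_three_le_ncard_neighborSet_le {G : SimpleGraph V} (hG : G.Connected) :
    #{v | 3 ≤ (G.neighborSet v).ncard} ≤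
      maxLeafNumber G * (1 + maxLeafNumber G + maxLeafNumber G * maxLeafNumber G) := by
  set l := maxLeafNumber G with hl
  have hdeg (v : V) : #(G.neighborFinset v) ≤ l := by
    rw [card_neighborFinset_eq_degree, ← ncard_neighborSet_eq_degree]
    exact ncard_neighborSet_le_maxLeafNumber hG v
  set B : Finset V := {v | 3 ≤ (G.neighborSet v).ncard} with hB
  obtain ⟨C, hC⟩ := (Set.toFinite {C : Finset V | C ⊆ B ∧ IsSeparated G C}).exists_maximal
    ⟨∅, by simp, fun a ha => by simp at ha⟩
  have hCl : #C ≤ l := hC.prop.2.card_le_maxLeafNumber hG fun v hv => by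
    simpa [hB] using hC.prop.1 hv
  have hcover : B ⊆ C.biUnion fun c =>
      insert c (G.neighborFinset c ∪ (G.neighborFinset c).biUnion fun x => G.neighborFinset x) := by
    intro b hb
    by_contra hnot
    simp only [mem_biUnion, mem_insert, mem_union, mem_neighborFinset, not_exists, not_and,
      not_or] at hnot
    have hins : insert b C ∈ {C : Finset V | C ⊆ B ∧ IsSeparated G C} := by
      refine ⟨insert_subset hb hC.prop.1, ?_⟩
      intro x hx y hy hxy
      rcases mem_insert.1 hx with rfl | hxC <;> rcases mem_insert.1 hy with rfl | hyC
      · exact absurd rfl hxy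
      · exact ⟨fun h => (hnot y hyC).2.1 h.symm, fun z h1 h2 => (hnot y hyC).2.2 z h2.symm h1.symm⟩
      · exact ⟨fun h => (hnot x hxC).2.1 h, fun z h1 h2 => (hnot x hxC).2.2 z h1 h2⟩
      · exact hC.prop.2 hxC hyC hxy
    exact (hnot b (hC.le_of_ge hins (subset_insert b C) (mem_insert_self b C))).1 rfl
  refine (card_le_card hcover).trans ((card_biUnion_le_card_mul _ _ (1 + l + l * l) ?_).trans
    (Nat.mul_le_mul_right _ hCl))
  intro c _
  have h1 := card_insert_le c
    (G.neighborFinset c ∪ (G.neighborFinset c).biUnion fun x => G.neighborFinset x)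
  have h2 := card_union_le (G.neighborFinset c)
    ((G.neighborFinset c).biUnion fun x => G.neighborFinset x)
  have h3 := card_biUnion_le_card_mul (G.neighborFinset c) (fun x => G.neighborFinset x) l
    fun x _ => hdeg x
  have h4 := hdeg c
  have h5 : #(G.neighborFinset c) * l ≤ l * l := Nat.mul_le_mul_right _ h4
  lia

open Classical in
lemma card_ncard_neighborSet_eq_one_le {G : SimpleGraph V} (hG : G.Connected) :
    #{v | (G.neighborSet v).ncard = 1} ≤ maxLeafNumber G := by
  obtain ⟨T, hTG, hT⟩ := hG.exists_isTree_le
  refine le_trans ?_ (leafCount_le_maxLeafNumber hTG hT)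
  rw [leafCount_eq_card]
  refine card_le_card fun v hv => ?_
  simp only [mem_filter, mem_univ, true_and] at hv ⊢
  obtain ⟨w, hw⟩ := Set.nonempty_of_ncard_ne_zero (s := G.neighborSet v) (by lia)
  have : Nontrivial V := ⟨v, w, G.ne_of_adj hw⟩
  obtain ⟨x, hx⟩ := hT.connected.preconnected.exists_adj_of_nontrivial v
  have h1 := hx.ncard_neighborSet_pos
  have h2 := ncard_neighborSet_mono hTG v
  lia

end Stars
/-! ### Branches are determined by their first edge -/

section Threads

/-- A walk of positive length between vertices of degree different from two, all of whose internal
vertices have degree two, and which never turns back along the edge it came from. Paths and cycles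
are treated alike. -/
structure IsThread {G : SimpleGraph V} {u v : V} (p : G.Walk u v) : Prop where
  length_pos : 0 < p.length
  ncard_start : (G.neighborSet u).ncard ≠ 2
  ncard_end : (G.neighborSet v).ncard ≠ 2
  ncard_internal : ∀ i, 0 < i → i < p.length → (G.neighborSet (p.getVert i)).ncard = 2
  ne : ∀ i, 0 < i → i < p.length → p.getVert (i - 1) ≠ p.getVert (i + 1)

variable {G : SimpleGraph V} {u v v' : V}

/-- A thread follows the only way onwards at each internal vertex. -/
lemma IsThread.getVert_eq {p : G.Walk u v} {q : G.Walk u v'} (hp : IsThread p) (hq : IsThread q)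
    (h : p.snd = q.snd) (i : ℕ) : i ≤ p.length → i ≤ q.length → p.getVert i = q.getVert i := by
  induction i using Nat.strong_induction_on with
  | _ i ih =>
    intro hip hiq
    match i, ih, hip, hiq with
    | 0, _, _, _ => simp
    | 1, _, _, _ => exact h
    | i + 2, ih, hip, hiq =>
      have h0 := ih i (by lia) (by lia) (by lia)
      have h1 := ih (i + 1) (by lia) (by lia) (by lia)
      have hpn := hp.ne (i + 1) (by lia) (by lia)
      have hqn := hq.ne (i + 1) (by lia) (by lia)
      simp only [Nat.add_sub_cancel] at hpn hqn
      obtain ⟨a, b, hab, hN⟩ := Set.ncard_eq_two.1 (hp.ncard_internal (i + 1) (by lia) (by lia))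
      have m0 : p.getVert i ∈ G.neighborSet (p.getVert (i + 1)) :=
        (p.adj_getVert_succ (by lia)).symm
      have m1 : p.getVert (i + 2) ∈ G.neighborSet (p.getVert (i + 1)) :=
        p.adj_getVert_succ (by lia)
      have m2 : q.getVert (i + 2) ∈ G.neighborSet (p.getVert (i + 1)) := by
        rw [h1]
        exact q.adj_getVert_succ (by lia)
      rw [hN] at m0 m1 m2
      simp only [Set.mem_insert_iff, Set.mem_singleton_iff] at m0 m1 m2
      grind

lemma IsThread.length_le {p : G.Walk u v} {q : G.Walk u v'} (hp : IsThread p) (hq : IsThread q)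
    (h : p.snd = q.snd) : p.length ≤ q.length := by
  by_contra! hlt
  have h1 := hp.ncard_internal q.length hq.length_pos hlt
  rw [hp.getVert_eq hq h _ hlt.le le_rfl, q.getVert_length] at h1
  exact hq.ncard_end h1

lemma IsThread.toSubgraph_eq {p : G.Walk u v} {q : G.Walk u v'} (hp : IsThread p)
    (hq : IsThread q) (h : p.snd = q.snd) : p.toSubgraph = q.toSubgraph := by
  have hl : p.length = q.length := (hp.length_le hq h).antisymm (hq.length_le hp h.symm)
  have hv : v = v' := by
    rw [← p.getVert_length, ← q.getVert_length, ← hl]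
    exact hp.getVert_eq hq h _ le_rfl hl.le
  subst hv
  rw [Walk.ext_getVert_le_length hl fun k hk => hp.getVert_eq hq h k hk (hl ▸ hk)]

end Threads

section Branches

variable {G : SimpleGraph V} {H : G.Subgraph} {u v : V}

/-- If the first vertex of a path of internal degree two had degree two in `G`, its second edge
would either prolong the path or close it to a cycle, so the path would not be maximal. -/
lemma IsBranch.ncard_start_ne_two [Finite V] {p : G.Walk u v} (hH : IsBranch G p.toSubgraph)
    (hp : p.IsPath) (hpos : 0 < p.length)
    (hint : ∀ x ∈ p.support, x ≠ u → x ≠ v → (G.neighborSet x).ncard = 2) :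
    (G.neighborSet u).ncard ≠ 2 := by
  intro h2
  have hnil : ¬ p.Nil := Walk.not_nil_iff_lt_length.2 hpos
  obtain ⟨w, hw, hws⟩ := Set.exists_ne_of_one_lt_ncard (by lia : 1 < (G.neighborSet u).ncard) p.snd
  have hnadj : ¬ p.toSubgraph.Adj u w := fun h => hws (hp.snd_of_toSubgraph_adj h).symm
  have hcons : p.toSubgraph ≤ (Walk.cons (G.adj_symm hw) p).toSubgraph := le_sup_right
  have hmax : ¬ (IsDegreeTwoPath G (Walk.cons (G.adj_symm hw) p).toSubgraph ∨
      IsDegreeTwoCycle G (Walk.cons (G.adj_symm hw) p).toSubgraph) := by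
    intro h
    refine hnadj ((hH.le_of_ge h hcons).2 ?_)
    simp
  have hint' : ∀ x ∈ (Walk.cons (G.adj_symm hw) p).support, x ≠ w → x ≠ v →
      (G.neighborSet x).ncard = 2 := by
    intro x hx hxw hxv
    rw [Walk.support_cons, List.mem_cons] at hx
    by_cases hxu : x = u
    · rw [hxu, h2]
    · exact hint x (hx.resolve_left hxw) hxu hxv
  by_cases hwp : w ∈ p.support
  · by_cases hwv : w = v
    · -- The edge from `w = v` to `u` closes the path to a cycle at `v`.
      subst hwv
      refine hmax (Or.inr ⟨w, _, (Walk.cons_isCycle_iff _ _).2 ⟨hp, fun h => hnadj ?_⟩,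
        fun x hx hxw => hint' x hx hxw hxw, rfl⟩)
      exact (Walk.adj_toSubgraph_iff_mem_edges.2 h).symm
    · -- An internal vertex has no third neighbor `u`: the path already uses both of its edges.
      obtain ⟨i, rfl, hi⟩ := Walk.mem_support_iff_exists_getVert.1 hwp
      have hi0 : i ≠ 0 := by
        rintro rfl
        rw [Walk.getVert_zero] at hw
        exact G.ne_of_adj hw rfl
      have hil : i ≠ p.length := by
        rintro rfl
        exact hwv p.getVert_length
      have hwu : p.getVert i ≠ u := (G.ne_of_adj hw).symm
      have heq : p.toSubgraph.neighborSet (p.getVert i) = G.neighborSet (p.getVert i) := by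
        refine Set.eq_of_subset_of_ncard_le (p.toSubgraph.neighborSet_subset _) ?_ (Set.toFinite _)
        rw [hp.ncard_neighborSet_toSubgraph_internal_eq_two hi0 (by lia), hint _ hwp hwu hwv]
      have hu : u ∈ p.toSubgraph.neighborSet (p.getVert i) := heq ▸ (G.adj_symm hw)
      exact hnadj (p.toSubgraph.adj_symm hu)
  · exact hmax (Or.inl ⟨w, v, _, hp.cons hwp, by simp, hint', rfl⟩)

lemma IsBranch.ncard_neighborSet_le_two (hH : IsBranch G H) (x : V) :
    (H.neighborSet x).ncard ≤ 2 := by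
  by_cases hx : x ∈ H.verts
  swap
  · have : H.neighborSet x = ∅ := Set.eq_empty_of_forall_notMem fun y hy => hx (H.edge_vert hy)
    simp [this]
  rcases hH.prop with ⟨u, v, p, hp, hpos, -, rfl⟩ | ⟨u, c, hc, -, rfl⟩
  · have hnil : ¬ p.Nil := Walk.not_nil_iff_lt_length.2 hpos
    rw [Walk.mem_verts_toSubgraph] at hx
    obtain ⟨i, rfl, hi⟩ := Walk.mem_support_iff_exists_getVert.1 hx
    by_cases h0 : i = 0
    · subst h0
      rw [p.getVert_zero, hp.neighborSet_toSubgraph_startpoint hnil, Set.ncard_singleton]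
      lia
    by_cases hl : i = p.length
    · subst hl
      rw [p.getVert_length, hp.neighborSet_toSubgraph_endpoint hnil, Set.ncard_singleton]
      lia
    exact (hp.ncard_neighborSet_toSubgraph_internal_eq_two h0 (by lia)).le
  · rw [Walk.mem_verts_toSubgraph] at hx
    exact (hc.ncard_neighborSet_toSubgraph_eq_two hx).le

/-- A nonempty subgraph of a connected graph that contains all edges at its vertices is the whole
graph. -/
lemma eq_top_of_neighborSet_eq (hG : G.Connected) (hne : H.verts.Nonempty)
    (h : ∀ x ∈ H.verts, H.neighborSet x = G.neighborSet x) : H = ⊤ := by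
  have hmem : ∀ {a b : V} (_ : G.Walk a b), a ∈ H.verts → b ∈ H.verts := by
    intro a b p
    induction p with
    | nil => exact id
    | cons hadj _ ih =>
      intro ha
      exact ih (H.edge_vert (H.adj_symm ((h _ ha).ge hadj)))
  obtain ⟨a, ha⟩ := hne
  have hall (b : V) : b ∈ H.verts := hmem (hG.preconnected a b).some ha
  refine top_le_iff.1 ⟨fun b _ => hall b, fun x y hxy => ?_⟩
  exact (h x (hall x)).ge hxy.adj_sub

/-- The exceptional case of a branch that is not a thread is a cycle that is the whole graph. -/
lemma IsBranch.eq_top_or_exists_isThread [Finite V] (hG : G.Connected) (hH : IsBranch G H) :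
    H = ⊤ ∨ ∃ (u v : V) (p : G.Walk u v), IsThread p ∧ p.toSubgraph = H := by
  rcases hH.prop with ⟨u, v, p, hp, hpos, hint, rfl⟩ | ⟨u, c, hc, hint, rfl⟩
  · refine Or.inr ⟨u, v, p, ⟨hpos, hH.ncard_start_ne_two hp hpos hint, ?_, ?_, ?_⟩, rfl⟩
    · refine IsBranch.ncard_start_ne_two (p := p.reverse) (by rwa [Walk.toSubgraph_reverse])
        hp.reverse (by simpa) fun x hx hxv hxu => hint x (by simpa using hx) hxu hxv
    · intro i hi0 hil
      refine hint _ (p.getVert_mem_support i) ?_ ?_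
      · rw [Ne, hp.getVert_eq_start_iff hil.le]
        lia
      · rw [Ne, hp.getVert_eq_end_iff hil.le]
        lia
    · intro i hi0 hil h
      have := hp.getVert_injOn (show i - 1 ≤ p.length by lia) (show i + 1 ≤ p.length by lia) h
      lia
  · by_cases hu : (G.neighborSet u).ncard = 2
    · refine Or.inl (eq_top_of_neighborSet_eq hG ⟨u, c.start_mem_verts_toSubgraph⟩ fun x hx => ?_)
      rw [Walk.mem_verts_toSubgraph] at hx
      refine Set.eq_of_subset_of_ncard_le (c.toSubgraph.neighborSet_subset _) ?_ (Set.toFinite _)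
      rw [hc.ncard_neighborSet_toSubgraph_eq_two hx]
      by_cases hxu : x = u
      · rw [hxu, hu]
      · rw [hint x hx hxu]
    · refine Or.inr ⟨u, u, c, ⟨?_, hu, hu, fun i hi0 hil => ?_, fun i hi0 hil => ?_⟩, rfl⟩
      · have := hc.three_le_length
        lia
      · refine hint _ (c.getVert_mem_support i) ?_
        rw [Ne, hc.getVert_endpoint_iff hil.le]
        lia
      · exact hc.getVert_sub_one_ne_getVert_add_one hil.le

/-- The branches other than the whole graph are determined by a vertex of degree different from two
and one of its neighbors. -/
lemma branchNumber_le_one_add_ncard [Finite V] (hG : G.Connected) :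
    branchNumber G ≤ 1 + {d : V × V | (G.neighborSet d.1).ncard ≠ 2 ∧ G.Adj d.1 d.2}.ncard := by
  have hle : ({H : G.Subgraph | IsBranch G H} \ {⊤}).ncard ≤
      {d : V × V | (G.neighborSet d.1).ncard ≠ 2 ∧ G.Adj d.1 d.2}.ncard := by
    have hex : ∀ H ∈ {H : G.Subgraph | IsBranch G H} \ {⊤},
        ∃ d : V × V, ∃ (v : V) (p : G.Walk d.1 v), IsThread p ∧ p.snd = d.2 ∧ p.toSubgraph = H := by
      rintro H ⟨hH, htop⟩
      obtain ⟨u, v, p, hp, h⟩ := (IsBranch.eq_top_or_exists_isThread hG hH).resolve_left htop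
      exact ⟨(u, p.snd), v, p, hp, rfl, h⟩
    have := hG.nonempty
    choose! f hf using hex
    refine Set.ncard_le_ncard_of_injOn f (fun H hH => ?_) (fun H hH H' hH' h => ?_) (Set.toFinite _)
    · obtain ⟨v, p, hp, hs, -⟩ := hf H hH
      exact ⟨hp.ncard_start, hs ▸ p.adj_snd (Walk.not_nil_iff_lt_length.2 hp.length_pos)⟩
    · obtain ⟨v, p, hp, hs, hpH⟩ := hf H hH
      obtain ⟨v', p', hp', hs', hpH'⟩ := hf H' hH'
      rw [← hpH, ← hpH']
      generalize f H = d at *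
      subst h
      exact hp.toSubgraph_eq hp' (hs.trans hs'.symm)
  have h := Set.ncard_le_ncard_sdiff_add_ncard {H : G.Subgraph | IsBranch G H} {⊤}
  rw [Set.ncard_singleton] at h
  unfold branchNumber
  lia

end Branches

/-! ### The two parameters bound each other -/

section Bounds

variable [Fintype V] {G : SimpleGraph V}

lemma branchNumber_le (hG : G.Connected) :
    branchNumber G ≤ 1 + (maxLeafNumber G + maxLeafNumber G *
      (1 + maxLeafNumber G + maxLeafNumber G * maxLeafNumber G)) * maxLeafNumber G := by
  classical
  refine (branchNumber_le_one_add_ncard hG).trans (Nat.add_le_add_left ?_ 1)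
  set A : Finset V := {v | (G.neighborSet v).ncard = 1}
  set B : Finset V := {v | 3 ≤ (G.neighborSet v).ncard}
  have hsub : {d : V × V | (G.neighborSet d.1).ncard ≠ 2 ∧ G.Adj d.1 d.2} ⊆
      ((A ∪ B).biUnion fun v => (G.neighborFinset v).image (Prod.mk v) : Finset (V × V)) := by
    rintro ⟨v, w⟩ ⟨h2, hvw⟩
    have := hvw.ncard_neighborSet_pos
    simp only [coe_biUnion, Set.mem_iUnion, mem_coe, mem_image, mem_neighborFinset]
    refine ⟨v, ?_, w, hvw, rfl⟩
    simp only [A, B, mem_union, mem_filter, mem_univ, true_and]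
    dsimp only at h2 this
    lia
  have h1 := Set.ncard_le_ncard hsub (finite_toSet _)
  rw [Set.ncard_coe_finset] at h1
  refine h1.trans ((card_biUnion_le_card_mul _ _ (maxLeafNumber G) fun v _ => ?_).trans
    (Nat.mul_le_mul_right _ ((card_union_le _ _).trans (Nat.add_le_add
      (card_ncard_neighborSet_eq_one_le hG) (card_three_le_ncard_neighborSet_le hG)))))
  refine card_image_le.trans ?_
  rw [card_neighborFinset_eq_degree, ← ncard_neighborSet_eq_degree]
  exact ncard_neighborSet_le_maxLeafNumber hG v

lemma exists_isBranch_adj {a b : V} (h : G.Adj a b) :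
    ∃ H : G.Subgraph, IsBranch G H ∧ H.Adj a b := by
  obtain ⟨H, hle, hH⟩ := (Set.toFinite {H : G.Subgraph | IsDegreeTwoPath G H ∨
    IsDegreeTwoCycle G H}).exists_le_maximal (a := h.toWalk.toSubgraph)
    (Or.inl ⟨a, b, h.toWalk, by simp [h.ne], by simp, fun x hx hxa hxb => by simp_all, rfl⟩)
  exact ⟨H, hH, hle.2 (by simp)⟩

open Classical in
lemma IsBranch.card_ncard_neighborSet_ne_two_le {H : G.Subgraph} (hH : IsBranch G H) :
    #{v | v ∈ H.verts ∧ (G.neighborSet v).ncard ≠ 2} ≤ 2 := by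
  obtain ⟨u, v, h⟩ : ∃ u v, ∀ x ∈ H.verts, x ≠ u → x ≠ v → (G.neighborSet x).ncard = 2 := by
    rcases hH.prop with ⟨u, v, p, -, -, hint, rfl⟩ | ⟨u, c, -, hint, rfl⟩
    · exact ⟨u, v, fun x hx => hint x (by simpa using hx)⟩
    · exact ⟨u, u, fun x hx hxu _ => hint x (by simpa using hx) hxu⟩
  refine (card_le_card (t := {u, v}) fun x hx => ?_).trans card_le_two
  simp only [mem_filter, mem_univ, true_and, mem_insert, mem_singleton] at hx ⊢
  by_contra! hne
  exact hx.2 (h x hx.1 hne.1 hne.2)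

lemma branchNumber_eq_card (G : SimpleGraph V) :
    branchNumber G = #(Set.toFinite {H : G.Subgraph | IsBranch G H}).toFinset := by
  rw [branchNumber, Set.ncard_eq_toFinset_card]

lemma ncard_neighborSet_le_two_mul_branchNumber (v : V) :
    (G.neighborSet v).ncard ≤ 2 * branchNumber G := by
  classical
  have hsub : G.neighborFinset v ⊆ (Set.toFinite {H : G.Subgraph | IsBranch G H}).toFinset.biUnion
      fun H => (H.neighborSet v).toFinite.toFinset := by
    intro w hw
    rw [mem_neighborFinset] at hw
    obtain ⟨H, hH, h⟩ := exists_isBranch_adj hw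
    simp only [mem_biUnion, Set.Finite.mem_toFinset]
    exact ⟨H, hH, h⟩
  rw [ncard_neighborSet_eq_degree, ← card_neighborFinset_eq_degree, branchNumber_eq_card, mul_comm]
  refine (card_le_card hsub).trans (card_biUnion_le_card_mul _ _ 2 fun H hH => ?_)
  rw [← Set.ncard_eq_toFinset_card]
  exact IsBranch.ncard_neighborSet_le_two (by simpa using hH) v

open Classical in
lemma card_ncard_neighborSet_ne_two_le :
    #{v | (G.neighborSet v).ncard ≠ 0 ∧ (G.neighborSet v).ncard ≠ 2} ≤ 2 * branchNumber G := by
  have hsub : ({v | (G.neighborSet v).ncard ≠ 0 ∧ (G.neighborSet v).ncard ≠ 2} : Finset V) ⊆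
      (Set.toFinite {H : G.Subgraph | IsBranch G H}).toFinset.biUnion
        fun H => {v | v ∈ H.verts ∧ (G.neighborSet v).ncard ≠ 2} := by
    intro v hv
    simp only [mem_filter, mem_univ, true_and] at hv
    obtain ⟨w, hw⟩ := Set.nonempty_of_ncard_ne_zero hv.1
    obtain ⟨H, hH, h⟩ := exists_isBranch_adj hw
    simp only [mem_biUnion, Set.Finite.mem_toFinset, mem_filter, mem_univ, true_and]
    exact ⟨H, hH, H.edge_vert h, hv.2⟩
  rw [branchNumber_eq_card, mul_comm]
  exact (card_le_card hsub).trans (card_biUnion_le_card_mul _ _ 2 fun H hH =>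
    IsBranch.card_ncard_neighborSet_ne_two_le (by simpa using hH))

/-- For a spanning tree `T`, the numbers `2 - deg_T v` add up to two. At a vertex of degree two in
`G` such a number is nonnegative, and it is one if the vertex is a leaf. So the number of these
leaves is bounded in terms of the vertices of degree different from two and their degrees. -/
lemma maxLeafNumber_le (hG : G.Connected) :
    maxLeafNumber G ≤ 2 * branchNumber G + (2 * branchNumber G * (2 * branchNumber G) + 2) := by
  classical
  obtain ⟨T, hTG, hT, hl⟩ := exists_isTree_leafCount_eq_maxLeafNumber hG
  set S : Finset V := {v | (G.neighborSet v).ncard ≠ 0 ∧ (G.neighborSet v).ncard ≠ 2}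
  have hS : #S ≤ 2 * branchNumber G := card_ncard_neighborSet_ne_two_le
  have hpoint (v : V) : ((if (T.neighborSet v).ncard = 1 then 1 else 0 : ℕ) : ℤ) ≤
      ((if v ∈ S then 1 + (G.neighborSet v).ncard else 0 : ℕ) : ℤ) +
        (2 - ((T.neighborSet v).ncard : ℤ)) := by
    have h := ncard_neighborSet_mono hTG v
    simp only [S, mem_filter, mem_univ, true_and]
    split_ifs <;> push_cast <;> lia
  have hsum := sum_le_sum fun v (_ : v ∈ univ) => hpoint v
  rw [sum_add_distrib, sum_two_sub_ncard_neighborSet_of_isTree hT, ← Nat.cast_sum, ← Nat.cast_sum,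
    ← card_filter, ← leafCount_eq_card, hl, ← sum_filter, filter_mem_eq_inter, univ_inter,
    sum_add_distrib, sum_const, smul_eq_mul, mul_one] at hsum
  have hdeg := sum_le_card_nsmul S (fun v => (G.neighborSet v).ncard) (2 * branchNumber G)
    fun v _ => ncard_neighborSet_le_two_mul_branchNumber v
  rw [smul_eq_mul] at hdeg
  have := Nat.mul_le_mul_right (2 * branchNumber G) hS
  lia

end Bounds

/-! ### Fixed-parameter tractability -/

section Tractability

lemma GraphAlgorithm.OutputsWithin.mono {A : GraphAlgorithm} {I : GraphInstance} {out : List Bool}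
    {s t : ℕ} (h : A.OutputsWithin I out s) (hst : s ≤ t) : A.OutputsWithin I out t :=
  h.map fun h => { h with steps_le_m := h.steps_le_m.trans hst }

lemma _root_.Computable.sum_range {f : ℕ → ℕ} (hf : Computable f) :
    Computable fun n => ∑ i ∈ range n, f i := by
  have h : Computable fun n : ℕ => Nat.rec (motive := fun _ => ℕ) 0 (fun i s => s + f i) n :=
    Computable.nat_rec .id (.const 0)
      ((Primrec.nat_add.to_comp.comp (Computable.snd.comp .snd)
        (hf.comp (Computable.fst.comp .snd))).to₂)
  refine h.of_eq fun n => ?_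
  induction n with
  | zero => simp
  | succ n ih => rw [sum_range_succ, ← ih]

/-- Tractability is inherited by every parameter in terms of which the given one can be bounded
computably. The running time `f` need not be monotone, so it is replaced by the sum of its values
up to the bound. -/
lemma GraphAlgorithm.IsFPT.of_le {A : GraphAlgorithm} {S : Set GraphInstance}
    {κ κ' : GraphInstance → ℕ} {g : ℕ → ℕ} (hg : Computable g) (hκ : ∀ I, κ I ≤ g (κ' I))
    (h : A.IsFPT S κ) : A.IsFPT S κ' := by
  obtain ⟨f, p, hf, hA⟩ := h
  refine ⟨fun m => ∑ i ∈ range (g m + 1), f i, p,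
    hf.sum_range.comp (Primrec.succ.to_comp.comp hg), fun I hI => ?_⟩
  obtain ⟨out, hout⟩ := hA I hI
  refine ⟨out, hout.mono (Nat.mul_le_mul_right _ ?_)⟩
  exact single_le_sum (f := f) (fun _ _ => Nat.zero_le _) (mem_range.2 (Nat.lt_succ_of_le (hκ I)))

lemma GraphAlgorithm.isFPT_maxLeafNumber_iff (A : GraphAlgorithm) (S : Set GraphInstance) :
    A.IsFPT S (fun I => maxLeafNumber I.graph) ↔ A.IsFPT S (fun I => branchNumber I.graph) := by
  have hadd {f g : ℕ → ℕ} (hf : Primrec f) (hg : Primrec g) : Primrec fun n => f n + g n :=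
    Primrec.nat_add.comp hf hg
  have hmul {f g : ℕ → ℕ} (hf : Primrec f) (hg : Primrec g) : Primrec fun n => f n * g n :=
    Primrec.nat_mul.comp hf hg
  constructor
  · refine GraphAlgorithm.IsFPT.of_le (g := fun n => 2 * n + (2 * n * (2 * n) + 2)) ?_
      fun I => maxLeafNumber_le I.connected
    have h2 : Primrec fun n => 2 * n := hmul (.const 2) .id
    exact (hadd h2 (hadd (hmul h2 h2) (.const 2))).to_comp
  · refine GraphAlgorithm.IsFPT.of_le (g := fun n => 1 + (n + n * (1 + n + n * n)) * n) ?_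
      fun I => branchNumber_le I.connected
    have h1 : Primrec fun n => 1 + n + n * n :=
      hadd (hadd (.const 1) .id) (hmul .id .id)
    exact (hadd (.const 1) (hmul (hadd .id (hmul .id h1)) .id)).to_comp

end Tractability
end ParamGraph

theorem mainTheorem5 :
    (∀ (A : ParamGraph.GraphAlgorithm) (S : Set ParamGraph.GraphInstance),
      A.IsFPT S (fun I => ParamGraph.maxLeafNumber I.graph) ↔
        A.IsFPT S (fun I => ParamGraph.branchNumber I.graph)) ∧
    (∀ P : ParamGraph.GraphProblem,
      P.IsFPT (fun I => ParamGraph.maxLeafNumber I.graph) ↔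
        P.IsFPT (fun I => ParamGraph.branchNumber I.graph)) :=
  ⟨fun A S => A.isFPT_maxLeafNumber_iff S, fun P =>
    exists_congr fun A => and_congr_right fun _ => A.isFPT_maxLeafNumber_iff P.instances⟩
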